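/- Let $f:\mathbb R^n\times\mathbb R^m\to\mathbb R$ be a $C^\infty$ function and let $(x^*,y^*)$ be a local Nash equilibrium of $\min_x\max_y f(x,y)$, i.e. there are neighborhoods $U$ of $x^*$ and $V$ of $y^*$ with $f(x,y^*)\ge f(x^*,y^*)\ge f(x^*,y)$ for all $x\in U$, $y\in V$. With all second derivatives evaluated at $(x^*,y^*)$, put $$\mathcal S=\begin{bmatrix}-\nabla_x^2 f&0\\0&\nabla_y^2 f\end{bmatrix},\qquad \mathcal A=\begin{bmatrix}0&-\nabla_{xy}f\\ \nabla_{yx}f&0\end{bmatrix},\qquad \mathcal J=\mathcal S+\mathcal A,$$ and let $\mathrm{Sp}(\mathcal J)\subset\mathbb C$ be the set of eigenvalues of $\mathcal J$. Assume that 1. $|\operatorname{Im}\lambda|>|\operatorname{Re}\lambda|$ for all $\lambda\in\mathrm{Sp}(\mathcal J)$; 2. no eigenvector $v\in\mathbb C^{n+m}\setminus\{0\}$ of $\mathcal A$ satisfies $\mathcal S v=0$. Let $\beta\in(-1,1)$ and let $h>0$ satisfy $$h<\min_{\lambda\in\mathrm{Sp}(\mathcal J)}\frac{2(1-\beta)^2}{1+\beta}\cdot\frac{|\operatorname{Re}\lambda|}{(\operatorname{Im}\lambda)^2-(\operatorname{Re}\lambda)^2}.$$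 Let $$\mathcal F(x,y)=\frac1{1-\beta}f(x,y)+\frac{h(1+\beta)}{4(1-\beta)^3}\left(\|\nabla_x f(x,y)\|^2-\|\nabla_y f(x,y)\|^2\right).$$ Then the system (Continuous Sim-HB) $$\dot x=-\nabla_x\mathcal F(x,y),\qquad \dot y=\nabla_y\mathcal F(x,y)$$ converges locally to $z^*=(x^*,y^*)$ at an exponential rate: there are $\delta,C,c>0$ such that for every $z_0\in\mathbb R^{n+m}$ with $\|z_0-z^*\|\le\delta$ the system has a solution on $[0,\infty)$ with $z(0)=z_0$, and every such solution satisfies $\|z(t)-z^*\|\le Ce^{-ct}\|z_0-z^*\|$ for all $t\ge0$. -/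

import Mathlib

open scoped ContDiff Topology

noncomputable section

namespace MinMaxGame

/-- The space `ℝ^k` with its Euclidean structure. -/
abbrev Euc (k : ℕ) : Type := EuclideanSpace ℝ (Fin k)

/-- `(xs, ys)` is a local Nash equilibrium of `min_x max_y f(x, y)`. -/
def IsLocalNash {n m : ℕ} (f : Euc n × Euc m → ℝ) (xs : Euc n) (ys : Euc m) : Prop :=
  ∃ U ∈ 𝓝 xs, ∃ V ∈ 𝓝 ys,
    (∀ x ∈ U, f (xs, ys) ≤ f (x, ys)) ∧ (∀ y ∈ V, f (xs, y) ≤ f (xs, ys))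

/-- The partial gradient `∇ₓ f`. -/
def gradX {n m : ℕ} (f : Euc n × Euc m → ℝ) (p : Euc n × Euc m) : Euc n :=
  gradient (fun x => f (x, p.2)) p.1

/-- The partial gradient `∇_y f`. -/
def gradY {n m : ℕ} (f : Euc n × Euc m → ℝ) (p : Euc n × Euc m) : Euc m :=
  gradient (fun y => f (p.1, y)) p.2

/-- The Jacobian matrix `(∂gᵢ/∂xⱼ)(x)` of a map between Euclidean spaces. -/
def jacobianMatrix {k l : ℕ} (g : Euc k → Euc l) (x : Euc k) : Matrix (Fin l) (Fin k) ℝ :=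
  Matrix.of fun i j => (fderiv ℝ g x (EuclideanSpace.single j 1)) i

/-- `∇²ₓ f`, with entries `∂²f/∂xᵢ∂xⱼ`. -/
def hessXX {n m : ℕ} (f : Euc n × Euc m → ℝ) (p : Euc n × Euc m) : Matrix (Fin n) (Fin n) ℝ :=
  jacobianMatrix (fun x => gradX f (x, p.2)) p.1

/-- `∇_{xy} f`, with entries `∂²f/∂xᵢ∂yⱼ`. -/
def hessXY {n m : ℕ} (f : Euc n × Euc m → ℝ) (p : Euc n × Euc m) : Matrix (Fin n) (Fin m) ℝ :=
  jacobianMatrix (fun y => gradX f (p.1, y)) p.2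

/-- `∇_{yx} f`, with entries `∂²f/∂yᵢ∂xⱼ`. -/
def hessYX {n m : ℕ} (f : Euc n × Euc m → ℝ) (p : Euc n × Euc m) : Matrix (Fin m) (Fin n) ℝ :=
  jacobianMatrix (fun x => gradY f (x, p.2)) p.1

/-- `∇²_y f`, with entries `∂²f/∂yᵢ∂yⱼ`. -/
def hessYY {n m : ℕ} (f : Euc n × Euc m → ℝ) (p : Euc n × Euc m) : Matrix (Fin m) (Fin m) ℝ :=
  jacobianMatrix (fun y => gradY f (p.1, y)) p.2

/-- The Jacobian `𝒥` of the gradient descent-ascent flow `x' = -∇ₓ f`, `y' = ∇_y f`. -/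
def gdaJacobian {n m : ℕ} (f : Euc n × Euc m → ℝ) (p : Euc n × Euc m) :
    Matrix (Fin n ⊕ Fin m) (Fin n ⊕ Fin m) ℝ :=
  Matrix.fromBlocks (-hessXX f p) (-hessXY f p) (hessYX f p) (hessYY f p)

/-- The potential part `𝒮` of the Jacobian. -/
def potentialPart {n m : ℕ} (f : Euc n × Euc m → ℝ) (p : Euc n × Euc m) :
    Matrix (Fin n ⊕ Fin m) (Fin n ⊕ Fin m) ℝ :=
  Matrix.fromBlocks (-hessXX f p) 0 0 (hessYY f p)

/-- The Hamiltonian part `𝒜` of the Jacobian. -/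
def hamiltonianPart {n m : ℕ} (f : Euc n × Euc m → ℝ) (p : Euc n × Euc m) :
    Matrix (Fin n ⊕ Fin m) (Fin n ⊕ Fin m) ℝ :=
  Matrix.fromBlocks 0 (-hessXY f p) (hessYX f p) 0

/-- A real matrix regarded as a complex one. -/
def toComplex {ι : Type} (M : Matrix ι ι ℝ) : Matrix ι ι ℂ :=
  M.map Complex.ofReal

/-- `Sp(M)`: the set of complex eigenvalues of a real square matrix. -/
def Sp {ι : Type} [Fintype ι] [DecidableEq ι] (M : Matrix ι ι ℝ) : Set ℂ :=
  spectrum ℂ (toComplex M)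

/-- Dominant interaction: `|Im μ| > |Re μ|` for every eigenvalue `μ` of `𝒥`. -/
def DominantInteraction {n m : ℕ} (f : Euc n × Euc m → ℝ) (p : Euc n × Euc m) : Prop :=
  ∀ μ ∈ Sp (gdaJacobian f p), |μ.re| < |μ.im|

/-- `EigVec(𝒜) ∩ Ker(𝒮) = {0}`: no complex eigenvector of `𝒜` is annihilated by `𝒮`. -/
def EigVecKerTrivial {n m : ℕ} (f : Euc n × Euc m → ℝ) (p : Euc n × Euc m) : Prop :=
  ∀ (μ : ℂ) (v : Fin n ⊕ Fin m → ℂ),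
    (toComplex (hamiltonianPart f p)).mulVec v = μ • v →
    (toComplex (potentialPart f p)).mulVec v = 0 → v = 0

/-- The modified loss `ℱ` with momentum parameter `β` and step size `h`. -/
def modifiedLoss {n m : ℕ} (f : Euc n × Euc m → ℝ) (β h : ℝ) (p : Euc n × Euc m) : ℝ :=
  1 / (1 - β) * f p
    + h * (1 + β) / (4 * (1 - β) ^ 3) * (‖gradX f p‖ ^ 2 - ‖gradY f p‖ ^ 2)

/-- The vector field of Continuous Sim-HB: `x' = -∇ₓ ℱ(x, y)`, `y' = ∇_y ℱ(x, y)`. -/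
def simHBField {n m : ℕ} (f : Euc n × Euc m → ℝ) (β h : ℝ) (p : Euc n × Euc m) :
    Euc n × Euc m :=
  (-gradX (modifiedLoss f β h) p, gradY (modifiedLoss f β h) p)

/-- `z` solves `z'(t) = g (z t)` on `[0, ∞)` (one-sided derivative at `0`). -/
def IsSolution {E : Type} [NormedAddCommGroup E] [NormedSpace ℝ E] (g : E → E) (z : ℝ → E) :
    Prop :=
  ∀ t ∈ Set.Ici (0 : ℝ), HasDerivWithinAt z (g (z t)) (Set.Ici 0) t

/-- Local convergence of `z' = g z` to `zs`, at an exponential rate: from every initial point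
close to `zs` a solution exists for all times `t ≥ 0`, and every such solution satisfies
`‖z t - zs‖ ≤ C e^{-ct} ‖z 0 - zs‖`.  The notion does not change if the norm is replaced by
an equivalent one. -/
def LocallyConverges {E : Type} [NormedAddCommGroup E] [NormedSpace ℝ E] (g : E → E) (zs : E) :
    Prop :=
  ∃ δ > (0 : ℝ), ∃ C > (0 : ℝ), ∃ c > (0 : ℝ), ∀ z₀ : E, ‖z₀ - zs‖ ≤ δ →
    (∃ z : ℝ → E, z 0 = z₀ ∧ IsSolution g z) ∧
    ∀ z : ℝ → E, z 0 = z₀ → IsSolution g z →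
      ∀ t : ℝ, 0 ≤ t → ‖z t - zs‖ ≤ C * Real.exp (-c * t) * ‖z₀ - zs‖

end MinMaxGame

end

/-! Let `H` be the Hessian of `f` at the equilibrium and `Λ = diag(-1, 1)`, so that `J = ΛH`. Both
partial gradients vanish there, so third derivatives of `f` drop out: the Hessian of `‖∇ₓf‖² -
‖∇_yf‖²` is `-2HΛH`, and applying `Λ` gives `-2J²`. Hence Sim-HB linearizes to `K = aJ - bJ²` with
`a = 1/(1-β)` and `b = h(1+β)/(2(1-β)³)` (`hasFDerivAt_simHBField`).

By spectral mapping, eigenvalues of `K` have real part `a Re ν + b((Im ν)² - (Re ν)²)` with `ν ∈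
Sp(J)`. The second-order Nash conditions make the symmetric part of `J` nonpositive, so `Re ν ≤ 0`.
Dominant interaction makes the bracket positive, and the bound on `h` says exactly that `a|Re ν|`
exceeds `b` times it. So every eigenvalue of `K` has negative real part.

`exists_lyapunov_matrix` then yields a quadratic Lyapunov function for `K`, and
`locallyConverges_of_quadratic_lyapunov` carries its decay over to the nonlinear flow. -/

open scoped ContDiff Topology

noncomputable section

namespace MinMaxGame

/-! ### Global existence and exponential decay from a quadratic Lyapunov function. -/

section Dynamics

variable {E : Type} [NormedAddCommGroup E] [NormedSpace ℝ E]

/-- If every point of a set `Ω` starts a solution on `[0, τ]` that ends in `Ω`, then every point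
of `Ω` starts a solution on `[0, ∞)`. -/
lemma exists_isSolution_of_uniform_time {g : E → E} {Ω : Set E} {τ : ℝ} (hτ : 0 < τ)
    (hloc : ∀ x ∈ Ω, ∃ α : ℝ → E, α 0 = x ∧ α τ ∈ Ω ∧
      ∀ t ∈ Set.Icc 0 τ, HasDerivWithinAt α (g (α t)) (Set.Icc 0 τ) t)
    {x : E} (hx : x ∈ Ω) : ∃ z : ℝ → E, z 0 = x ∧ IsSolution g z := by
  choose! α hα0 hατ hαd using hloc
  let p : ℕ → E := fun k => (fun y => α y τ)^[k] x
  have hp_succ : ∀ k, p (k + 1) = α (p k) τ := fun k => Function.iterate_succ_apply' _ _ _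
  have hp : ∀ k, p k ∈ Ω := by
    intro k
    induction k with
    | zero => exact hx
    | succ k ih => rw [hp_succ]; exact hατ _ ih
  let z : ℝ → E := fun t => α (p ⌊t / τ⌋₊) (t - ⌊t / τ⌋₊ * τ)
  have hz : ∀ k : ℕ, ∀ t ∈ Set.Icc (k * τ) ((k + 1 : ℕ) * τ), z t = α (p k) (t - k * τ) := by
    intro k t ht
    -- At the right endpoint the floor has already jumped to `k + 1`; the two pieces agree there
    -- because `p (k + 1)` is the endpoint of piece `k`.
    rcases eq_or_lt_of_le ht.2 with h | h
    · have hfl : ⌊t / τ⌋₊ = k + 1 := by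
        rw [h, mul_div_cancel_right₀ _ hτ.ne', Nat.floor_natCast]
      simp only [z, hfl]
      rw [h, sub_self, hα0 _ (hp _), hp_succ]
      congr 1
      push_cast
      ring
    · have hk : (k : ℝ) ≤ t / τ := (le_div_iff₀ hτ).2 ht.1
      have hfl : ⌊t / τ⌋₊ = k := by
        rw [Nat.floor_eq_iff (le_trans (Nat.cast_nonneg k) hk)]
        refine ⟨hk, (div_lt_iff₀ hτ).2 (by exact_mod_cast h)⟩
      simp only [z, hfl]
  have hzd : ∀ k : ℕ, ∀ t ∈ Set.Icc (k * τ) ((k + 1 : ℕ) * τ),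
      HasDerivWithinAt z (g (z t)) (Set.Icc (k * τ) ((k + 1 : ℕ) * τ)) t := by
    intro k t ht
    have hmaps : Set.MapsTo (fun s : ℝ => s - k * τ) (Set.Icc (k * τ) ((k + 1 : ℕ) * τ))
        (Set.Icc 0 τ) := by
      intro s hs
      refine ⟨sub_nonneg.2 hs.1, ?_⟩
      have := hs.2
      push_cast at this
      simp only
      linarith
    have h1 := hαd _ (hp k) _ (hmaps ht)
    have h2 := h1.scomp t (((hasDerivAt_id t).sub_const (k * τ)).hasDerivWithinAt) hmaps
    rw [one_smul] at h2
    rw [hz k t ht]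
    exact h2.congr (fun s hs => hz k s hs) (hz k t ht)
  refine ⟨z, ?_, ?_⟩
  · have h0 : (0 : ℝ) ∈ Set.Icc ((0 : ℕ) * τ) ((0 + 1 : ℕ) * τ) := by simp [hτ.le]
    rw [hz 0 0 h0]
    simp only [Nat.cast_zero, zero_mul, sub_zero]
    exact hα0 _ hx
  intro t ht
  have ht0 : (0 : ℝ) ≤ t := ht
  have hfl := Nat.floor_le (div_nonneg ht0 hτ.le)
  have hfl' := Nat.lt_floor_add_one (t / τ)
  rw [le_div_iff₀ hτ] at hfl
  rw [div_lt_iff₀ hτ] at hfl'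
  set k := ⌊t / τ⌋₊ with hk
  have hmem : t ∈ Set.Icc (k * τ) ((k + 1 : ℕ) * τ) := ⟨hfl, by push_cast; exact hfl'.le⟩
  have hright : HasDerivWithinAt z (g (z t)) (Set.Ici t) t := by
    refine (hzd k t hmem).mono_of_mem_nhdsWithin ?_
    refine Filter.mem_of_superset (Icc_mem_nhdsGE (show t < (k + 1 : ℕ) * τ by push_cast; exact hfl'))
      (Set.Icc_subset_Icc_left hfl)
  rcases eq_or_lt_of_le ht0 with h0 | h0
  · rw [← h0] at hright ⊢
    exact hright
  have hleft : HasDerivWithinAt z (g (z t)) (Set.Iic t) t := by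
    rcases eq_or_lt_of_le hfl with h | h
    -- At a positive junction time the left derivative comes from the preceding piece.
    · obtain ⟨j, hj⟩ : ∃ j, k = j + 1 := by
        refine Nat.exists_eq_succ_of_ne_zero fun hk0 => ?_
        rw [hk0] at h
        simp at h
        exact h0.ne h
      rw [hj] at h
      have hlt : (j : ℝ) * τ < t := by
        rw [← h]; push_cast; linarith
      refine (hzd j t ⟨hlt.le, h.ge⟩).mono_of_mem_nhdsWithin ?_
      exact Filter.mem_of_superset (Icc_mem_nhdsLE hlt) (Set.Icc_subset_Icc_right h.ge)
    · refine (hzd k t hmem).mono_of_mem_nhdsWithin ?_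
      exact Filter.mem_of_superset (Icc_mem_nhdsLE h) (Set.Icc_subset_Icc_right hmem.2)
  have := hleft.union hright
  rw [Set.Iic_union_Ici] at this
  exact this.mono (Set.subset_univ _)

/-- Decay of a quadratic Lyapunov function along a solution on `[0, T]`. -/
lemma quadratic_lyapunov_decay {g : E → E} {zs : E} (B : E →L[ℝ] E →L[ℝ] ℝ)
    (hsymm : ∀ x y, B x y = B y x) {c w : ℝ} (hc : 0 ≤ c)
    (hdec : ∀ x, 0 < B (x - zs) (x - zs) → B (x - zs) (x - zs) < w →
      2 * B (x - zs) (g x) < -(2 * c) * B (x - zs) (x - zs))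
    (hnonneg : ∀ x, 0 ≤ B x x) {T : ℝ} {z : ℝ → E} (hcont : ContinuousOn z (Set.Icc 0 T))
    (hz : ∀ t ∈ Set.Ico 0 T, HasDerivWithinAt z (g (z t)) (Set.Ici t) t)
    (h0 : B (z 0 - zs) (z 0 - zs) < w) {t : ℝ} (ht : t ∈ Set.Icc 0 T) :
    B (z t - zs) (z t - zs) ≤ Real.exp (-(2 * c) * t) * B (z 0 - zs) (z 0 - zs) := by
  set W : ℝ → ℝ := fun s => B (z s - zs) (z s - zs) with hW
  have hWcont : ContinuousOn W (Set.Icc 0 T) := by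
    have h1 : ContinuousOn (fun s => z s - zs) (Set.Icc 0 T) := hcont.sub continuousOn_const
    exact (B.continuous.comp_continuousOn h1).clm_apply h1
  have hWd : ∀ s ∈ Set.Ico 0 T,
      HasDerivWithinAt W (2 * B (z s - zs) (g (z s))) (Set.Ici s) s := by
    intro s hs
    have h1 := (hz s hs).sub_const zs
    have h2 := B.hasFDerivAt.comp_hasDerivWithinAt s h1
    have h3 := h2.clm_apply h1
    refine h3.congr_deriv ?_
    rw [hsymm (g (z s)), Function.comp_apply]
    ring
  -- The comparison principle needs strict decrease where `W` meets the barrier, and `hdec` gives it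
  -- only for `0 < W < w`. Starting the barrier at `W 0 + ε` keeps it in this range even when `W 0 =
  -- 0`; then `ε → 0`.
  have key : ∀ ε : ℝ, 0 < ε → W 0 + ε < w →
      W t ≤ (W 0 + ε) * Real.exp (-(2 * c) * t) := by
    intro ε hε hεw
    have hpos : 0 < W 0 + ε := add_pos_of_nonneg_of_pos (hnonneg _) hε
    refine image_le_of_deriv_right_lt_deriv_boundary
      (B := fun s => (W 0 + ε) * Real.exp (-(2 * c) * s))
      (B' := fun s => (W 0 + ε) * (Real.exp (-(2 * c) * s) * (-(2 * c)))) hWcont hWd ?_ ?_ ?_ ht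
    · simp [hε.le]
    · intro s
      have := ((hasDerivAt_id s).const_mul (-(2 * c))).exp.const_mul (W 0 + ε)
      simpa using this
    · intro s hs hWs
      have hle : Real.exp (-(2 * c) * s) ≤ 1 :=
        Real.exp_le_one_iff.2 (by nlinarith [hs.1])
      have hlt := hdec (z s) (by
          change 0 < W s
          rw [hWs]; exact mul_pos hpos (Real.exp_pos _))
        (by
          change W s < w
          rw [hWs]; exact lt_of_le_of_lt (mul_le_of_le_one_right hpos.le hle) hεw)
      refine hlt.trans_eq ?_
      change -(2 * c) * W s = _
      rw [hWs]
      ring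
  have hlim : Filter.Tendsto (fun ε : ℝ => (W 0 + ε) * Real.exp (-(2 * c) * t)) (𝓝[>] 0)
      (𝓝 ((W 0 + 0) * Real.exp (-(2 * c) * t))) :=
    (((continuous_const.add continuous_id).mul continuous_const).tendsto 0).mono_left
      nhdsWithin_le_nhds
  have hev : ∀ᶠ ε : ℝ in 𝓝[>] 0, W t ≤ (W 0 + ε) * Real.exp (-(2 * c) * t) := by
    filter_upwards [Ioo_mem_nhdsGT (sub_pos.2 h0)] with ε hε
    exact key ε hε.1 (by have := hε.2; simp only [hW] at *; linarith)
  have := ge_of_tendsto hlim hev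
  rw [add_zero, mul_comm] at this
  exact this

/-- Lyapunov's indirect method: a quadratic Lyapunov function for the linearization of a `C¹`
vector field at a zero yields local exponential convergence. -/
theorem locallyConverges_of_quadratic_lyapunov [CompleteSpace E] {g : E → E} {zs : E}
    {A : E →L[ℝ] E} (hg : ContDiffAt ℝ 1 g zs) (hg0 : g zs = 0) (hA : HasFDerivAt g A zs)
    (B : E →L[ℝ] E →L[ℝ] ℝ) (hsymm : ∀ x y, B x y = B y x) {a b : ℝ} (ha : 0 < a) (hb : 0 < b)
    (hlow : ∀ x, a * ‖x‖ ^ 2 ≤ B x x) (hneg : ∀ x, B x (A x) ≤ -b * ‖x‖ ^ 2) :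
    LocallyConverges g zs := by
  set M : ℝ := ‖B‖ + 1 with hM
  have hMpos : 0 < M := by positivity
  have hup : ∀ x y, |B x y| ≤ M * ‖x‖ * ‖y‖ := by
    intro x y
    refine (B.le_opNorm₂ x y).trans ?_
    gcongr
    linarith
  have hnonneg : ∀ x, 0 ≤ B x x := fun x => le_trans (by positivity) (hlow x)
  -- The same constant bounds the linearization error: it costs at most `b/2 * ‖u‖²` of the decay
  -- `2b * ‖u‖²`, and `2c * B u u` takes at most another `b/2 * ‖u‖²`.
  set c : ℝ := b / (4 * M) with hc
  have hcpos : 0 < c := by positivity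
  obtain ⟨r₁, hr₁, ε, hε, hloc⟩ :=
    hg.exists_forall_mem_closedBall_exists_eq_forall_mem_Ioo_hasDerivAt 0
  have hlin := hA.isLittleO.def (c := b / (4 * M)) (by positivity)
  obtain ⟨r₂, hr₂, hball⟩ := Metric.eventually_nhds_iff_ball.1 hlin
  set r := min r₁ r₂ with hr
  have hrpos : 0 < r := lt_min hr₁ hr₂
  -- Coercivity puts the sublevel set `{B < w}` inside the ball of radius `r`, where both the
  -- uniform existence time and the linearization estimate hold.
  set w : ℝ := a * r ^ 2 with hw
  have hsub : ∀ x, B (x - zs) (x - zs) < w → ‖x - zs‖ < r := by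
    intro x hx
    have h1 : a * ‖x - zs‖ ^ 2 < a * r ^ 2 := (hlow _).trans_lt hx
    exact lt_of_pow_lt_pow_left₀ 2 hrpos.le (lt_of_mul_lt_mul_left h1 ha.le)
  have hdec : ∀ x, 0 < B (x - zs) (x - zs) → B (x - zs) (x - zs) < w →
      2 * B (x - zs) (g x) < -(2 * c) * B (x - zs) (x - zs) := by
    intro x hx0 hx
    have hxr := hsub x hx
    have hrem := hball x (by
      rw [Metric.mem_ball, dist_eq_norm]; exact hxr.trans_le (min_le_right _ _))
    rw [hg0, sub_zero] at hrem
    set u := x - zs with hu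
    have hupos : 0 < ‖u‖ := by
      rw [norm_pos_iff]
      rintro h
      rw [h] at hx0
      simp at hx0
    have hsplit : B u (g x) = B u (A u) + B u (g x - A u) := by
      rw [← map_add]; congr 1; abel
    have h1 : B u (g x - A u) ≤ b / 4 * ‖u‖ ^ 2 := by
      calc B u (g x - A u) ≤ M * ‖u‖ * ‖g x - A u‖ := (le_abs_self _).trans (hup _ _)
        _ ≤ M * ‖u‖ * (b / (4 * M) * ‖u‖) := by gcongr
        _ = b / 4 * ‖u‖ ^ 2 := by field_simp
    have h2 : 2 * c * B u u ≤ b / 2 * ‖u‖ ^ 2 := by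
      calc 2 * c * B u u ≤ 2 * c * (M * ‖u‖ * ‖u‖) := by
            gcongr
            exact (le_abs_self _).trans (hup _ _)
        _ = b / 2 * ‖u‖ ^ 2 := by rw [hc]; field_simp; ring
    have h3 := hneg u
    have h4 : 0 < b * ‖u‖ ^ 2 := by positivity
    rw [hsplit]
    linarith
  have hex : ∀ x, B (x - zs) (x - zs) < w → ∃ z : ℝ → E, z 0 = x ∧ IsSolution g z := by
    intro x hx
    -- Decay of the Lyapunov function makes the sublevel set forward invariant; halving `ε` fits a
    -- closed time interval into the open one.
    refine exists_isSolution_of_uniform_time (Ω := {y | B (y - zs) (y - zs) < w}) (half_pos hε)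
      ?_ hx
    intro y hy
    obtain ⟨α, hα0, hαd⟩ := hloc y (by
      rw [Metric.mem_closedBall, dist_eq_norm]
      exact ((hsub y hy).trans_le (min_le_left _ _)).le)
    have hd : ∀ t ∈ Set.Icc 0 (ε / 2), HasDerivAt α (g (α t)) t := fun t ht =>
      hαd t ⟨by linarith [ht.1], by linarith [ht.2]⟩
    refine ⟨α, hα0, ?_, fun t ht => (hd t ht).hasDerivWithinAt⟩
    have hy' : B (α 0 - zs) (α 0 - zs) < w := by rw [hα0]; exact hy
    have := quadratic_lyapunov_decay B hsymm hcpos.le hdec hnonneg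
      (fun t ht => (hd t ht).continuousAt.continuousWithinAt)
      (fun t ht => (hd t (Set.Ico_subset_Icc_self ht)).hasDerivWithinAt) hy'
      (Set.right_mem_Icc.2 (half_pos hε).le)
    refine lt_of_le_of_lt (this.trans (mul_le_of_le_one_left (hnonneg _) ?_)) hy'
    exact Real.exp_le_one_iff.2 (by nlinarith)
  obtain ⟨δ, hδ, hδw⟩ : ∃ δ > (0 : ℝ), ∀ x, ‖x - zs‖ ≤ δ → B (x - zs) (x - zs) < w := by
    have hcont : Continuous fun x => B (x - zs) (x - zs) := by fun_prop
    have hev : ∀ᶠ x in 𝓝 zs, B (x - zs) (x - zs) < w := by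
      refine hcont.continuousAt.eventually_lt continuousAt_const ?_
      simp only [sub_self, map_zero]
      positivity
    obtain ⟨δ, hδ, h⟩ := Metric.nhds_basis_closedBall.eventually_iff.1 hev
    exact ⟨δ, hδ, fun x hx => h (by rwa [Metric.mem_closedBall, dist_eq_norm])⟩
  refine ⟨δ, hδ, Real.sqrt (M / a), Real.sqrt_pos.2 (by positivity), c, hcpos, ?_⟩
  intro z₀ hz₀
  refine ⟨hex z₀ (hδw z₀ hz₀), ?_⟩
  intro z hz0 hz t ht
  have hdecay := quadratic_lyapunov_decay B hsymm hcpos.le hdec hnonneg (T := t)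
    (fun s hs => (hz s hs.1).continuousWithinAt.mono fun _ h => h.1)
    (fun s hs => (hz s hs.1).mono (Set.Ici_subset_Ici.2 hs.1))
    (by rw [hz0]; exact hδw z₀ hz₀) (Set.right_mem_Icc.2 ht)
  rw [hz0] at hdecay
  refine (pow_le_pow_iff_left₀ (norm_nonneg _) (by positivity) two_ne_zero).1 ?_
  have hexp : Real.exp (-c * t) ^ 2 = Real.exp (-(2 * c) * t) := by
    rw [← Real.exp_nat_mul]; congr 1; push_cast; ring
  rw [mul_pow, mul_pow, Real.sq_sqrt (by positivity), hexp, div_mul_eq_mul_div, div_mul_eq_mul_div,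
    le_div_iff₀ ha]
  calc ‖z t - zs‖ ^ 2 * a = a * ‖z t - zs‖ ^ 2 := mul_comm _ _
    _ ≤ _ := hlow _
    _ ≤ _ := hdecay
    _ ≤ Real.exp (-(2 * c) * t) * (M * ‖z₀ - zs‖ * ‖z₀ - zs‖) := by
      gcongr
      exact (le_abs_self _).trans (hup _ _)
    _ = _ := by ring

end Dynamics

/-! ### Gelfand's formula, spectral mapping and Lyapunov's theorem for matrices. -/

section SpectralTheory

open Matrix

variable {ι : Type} [Fintype ι] [DecidableEq ι]

attribute [local instance] Matrix.linftyOpNormedRing Matrix.linftyOpNormedAlgebra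

/-- Powers of a complex matrix whose eigenvalues lie in the open unit disc tend to zero. -/
lemma tendsto_pow_zero_of_spectrum_lt_one (T : Matrix ι ι ℂ)
    (hT : ∀ μ ∈ spectrum ℂ T, ‖μ‖ < 1) :
    Filter.Tendsto (fun k : ℕ => T ^ k) Filter.atTop (𝓝 0) := by
  cases subsingleton_or_nontrivial (Matrix ι ι ℂ) with
  | inl h =>
    simp only [Subsingleton.elim _ (0 : Matrix ι ι ℂ)]
    exact tendsto_const_nhds
  | inr h =>
  have hrad : spectralRadius ℂ T < (1 : NNReal) :=
    spectrum.spectralRadius_lt_of_forall_lt T (r := 1) fun μ hμ => by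
      exact_mod_cast hT μ hμ
  -- By Gelfand's formula, `‖T ^ k‖ ≤ q ^ k` eventually for any `q` above the spectral radius.
  obtain ⟨q, hq, hq1⟩ := ENNReal.lt_iff_exists_nnreal_btwn.1 hrad
  have hev := (spectrum.pow_nnnorm_pow_one_div_tendsto_nhds_spectralRadius T).eventually_lt_const hq
  refine tendsto_zero_iff_norm_tendsto_zero.2 ?_
  refine squeeze_zero' (g := fun k : ℕ => (q : ℝ) ^ k) (.of_forall fun _ => norm_nonneg _) ?_
    (tendsto_pow_atTop_nhds_zero_of_lt_one q.2 (by exact_mod_cast hq1))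
  filter_upwards [hev, Filter.eventually_gt_atTop 0] with k hk hk0
  have h1 := ENNReal.rpow_le_rpow hk.le (z := (k : ℝ)) (by positivity)
  rw [← ENNReal.rpow_mul, one_div_mul_cancel (by positivity), ENNReal.rpow_one,
    ENNReal.rpow_natCast] at h1
  exact_mod_cast h1

lemma toComplex_eq_mapMatrix (M : Matrix ι ι ℝ) :
    toComplex M = (Complex.ofRealHom.mapMatrix : Matrix ι ι ℝ →+* Matrix ι ι ℂ) M := rfl

/-- The real version of `tendsto_pow_zero_of_spectrum_lt_one`. -/
lemma tendsto_pow_zero_of_Sp_lt_one (T : Matrix ι ι ℝ) (hT : ∀ μ ∈ Sp T, ‖μ‖ < 1) :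
    Filter.Tendsto (fun k : ℕ => T ^ k) Filter.atTop (𝓝 0) := by
  have h := tendsto_pow_zero_of_spectrum_lt_one (toComplex T) hT
  have hre : Continuous fun M : Matrix ι ι ℂ => M.map Complex.re :=
    continuous_id.matrix_map Complex.continuous_re
  have h2 := (hre.tendsto 0).comp h
  simp only [Matrix.map_zero _ Complex.zero_re] at h2
  refine h2.congr fun k => ?_
  ext i j
  simp only [Function.comp_apply, toComplex_eq_mapMatrix, ← map_pow]
  simp

/-- The spectral mapping theorem for `d + aM + bM²`, as an inclusion. -/
lemma exists_of_mem_Sp_quadratic (M : Matrix ι ι ℝ) {a b d : ℝ} (ha : a ≠ 0 ∨ b ≠ 0) {μ : ℂ}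
    (hμ : μ ∈ Sp (d • (1 : Matrix ι ι ℝ) + a • M + b • (M * M))) :
    ∃ ν ∈ Sp M, μ = d + a * ν + b * ν ^ 2 := by
  open Polynomial in
  have hmap : toComplex (d • (1 : Matrix ι ι ℝ) + a • M + b • (M * M)) =
      Polynomial.aeval (toComplex M) (C (d : ℂ) + C (a : ℂ) * X + C (b : ℂ) * X ^ 2) := by
    simp only [map_add, map_mul, aeval_C, aeval_X, pow_two,
      Algebra.algebraMap_eq_smul_one]
    ext i j
    simp [toComplex, Matrix.mul_apply, Matrix.one_apply, apply_ite]
  -- Positive degree allows spectral mapping without a nonempty spectrum, which a matrix of size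
  -- zero lacks.
  open Polynomial in
  have hdeg : 0 < (C (d : ℂ) + C (a : ℂ) * X + C (b : ℂ) * X ^ 2).degree := by
    by_contra hcon
    have h := eq_C_of_degree_le_zero (not_lt.1 hcon)
    have h1 := congrArg (coeff · 1) h
    have h2 := congrArg (coeff · 2) h
    simp [coeff_X, coeff_C] at h1 h2
    tauto
  rw [Sp, hmap, spectrum.map_polynomial_aeval_of_degree_pos _ _ hdeg] at hμ
  obtain ⟨ν, hν, rfl⟩ := hμ
  exact ⟨ν, hν, by simp⟩

/-- **Lyapunov's theorem**: a real matrix whose eigenvalues have negative real part admits a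
quadratic Lyapunov function. -/
theorem exists_lyapunov_matrix (K : Matrix ι ι ℝ) (hK : ∀ μ ∈ Sp K, μ.re < 0) :
    ∃ P : Matrix ι ι ℝ, Pᵀ = P ∧ (∀ x, x ⬝ᵥ x ≤ x ⬝ᵥ P *ᵥ x) ∧
      ∃ b > (0 : ℝ), ∀ x, x ⬝ᵥ P *ᵥ (K *ᵥ x) ≤ -b * (x ⬝ᵥ x) := by
  -- A small Euler step `1 + εK` has spectrum in the open unit disc, so a finite sum over its powers
  -- can replace the integral of `exp(tK)ᵀ exp(tK)`.
  obtain ⟨ε, hε, hεs⟩ : ∃ ε > (0 : ℝ), ∀ μ ∈ Sp K, ‖1 + ε * μ‖ < 1 := by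
    have hev : ∀ μ ∈ Sp K, ∀ᶠ ε : ℝ in 𝓝[>] 0, ‖1 + (ε : ℂ) * μ‖ < 1 := by
      intro μ hμ
      have hneg := hK μ hμ
      have hlim : Filter.Tendsto (fun ε : ℝ => 2 * μ.re + ε * ‖μ‖ ^ 2) (𝓝[>] 0)
          (𝓝 (2 * μ.re + 0 * ‖μ‖ ^ 2)) :=
        (Continuous.tendsto (by fun_prop) 0).mono_left nhdsWithin_le_nhds
      have hlt := hlim.eventually_lt_const (u := 0) (by linarith)
      filter_upwards [hlt, self_mem_nhdsWithin] with ε h1 h2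
      have h2 : 0 < ε := h2
      refine lt_of_pow_lt_pow_left₀ 2 zero_le_one ?_
      have : ‖1 + (ε : ℂ) * μ‖ ^ 2 = 1 + ε * (2 * μ.re + ε * ‖μ‖ ^ 2) := by
        rw [← Complex.normSq_eq_norm_sq, ← Complex.normSq_eq_norm_sq, Complex.normSq_apply,
          Complex.normSq_apply]
        simp
        ring
      rw [this]
      nlinarith
    have hfin : (Sp K).Finite := Matrix.finite_spectrum _
    have hall := (Filter.eventually_all_finite hfin).2 hev
    obtain ⟨ε, h1, h2⟩ := (hall.and self_mem_nhdsWithin).exists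
    exact ⟨ε, h2, h1⟩
  set T : Matrix ι ι ℝ := 1 + ε • K with hTdef
  have hT : ∀ μ ∈ Sp T, ‖μ‖ < 1 := by
    intro μ hμ
    have hT' : T = (1 : ℝ) • (1 : Matrix ι ι ℝ) + ε • K + (0 : ℝ) • (K * K) := by simp [hTdef]
    rw [hT'] at hμ
    obtain ⟨ν, hν, rfl⟩ := exists_of_mem_Sp_quadratic K (.inl hε.ne') hμ
    simpa using hεs ν hν
  have hsmall : ∃ N : ℕ, 0 < N ∧ ∀ x, (T ^ N *ᵥ x) ⬝ᵥ (T ^ N *ᵥ x) ≤ 1 / 2 * (x ⬝ᵥ x) := by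
    have hcont : Continuous fun S : Matrix ι ι ℝ => ∑ i, ∑ j, S i j ^ 2 := by fun_prop
    have hlim := (hcont.tendsto 0).comp (tendsto_pow_zero_of_Sp_lt_one T hT)
    simp only [Matrix.zero_apply, ne_eq, OfNat.ofNat_ne_zero, not_false_eq_true, zero_pow,
      Finset.sum_const_zero] at hlim
    have hev := hlim.eventually_lt_const (show (0 : ℝ) < 1 / 2 by norm_num)
    obtain ⟨N, hN, hN0⟩ := (hev.and (Filter.eventually_gt_atTop 0)).exists
    refine ⟨N, hN0, fun x => ?_⟩
    calc (T ^ N *ᵥ x) ⬝ᵥ (T ^ N *ᵥ x) = ∑ i, (∑ j, (T ^ N) i j * x j) ^ 2 := by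
          simp only [dotProduct, Matrix.mulVec, pow_two]
      _ ≤ ∑ i, (∑ j, (T ^ N) i j ^ 2) * ∑ j, x j ^ 2 :=
          Finset.sum_le_sum fun i _ => Finset.sum_mul_sq_le_sq_mul_sq _ _ _
      _ = (∑ i, ∑ j, (T ^ N) i j ^ 2) * (x ⬝ᵥ x) := by
          rw [← Finset.sum_mul]; simp only [dotProduct, pow_two]
      _ ≤ 1 / 2 * (x ⬝ᵥ x) :=
          mul_le_mul_of_nonneg_right hN.le (Finset.sum_nonneg fun i _ => mul_self_nonneg _)
  obtain ⟨N, hN, hhalf⟩ := hsmall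
  set P : Matrix ι ι ℝ := ∑ k ∈ Finset.range N, (T ^ k)ᵀ * T ^ k with hP
  have hform : ∀ x y, x ⬝ᵥ P *ᵥ y = ∑ k ∈ Finset.range N, (T ^ k *ᵥ x) ⬝ᵥ (T ^ k *ᵥ y) := by
    intro x y
    rw [hP, Matrix.sum_mulVec, dotProduct_sum]
    refine Finset.sum_congr rfl fun k _ => ?_
    rw [← Matrix.mulVec_mulVec, Matrix.dotProduct_mulVec, Matrix.vecMul_transpose]
  have hnn : ∀ x : ι → ℝ, 0 ≤ x ⬝ᵥ x := fun x => Finset.sum_nonneg fun i _ => mul_self_nonneg _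
  have hPnn : ∀ x, 0 ≤ x ⬝ᵥ P *ᵥ x := fun x => by
    rw [hform]; exact Finset.sum_nonneg fun k _ => hnn _
  have hsymm : Pᵀ = P := by
    rw [hP, Matrix.transpose_sum]
    simp [Matrix.transpose_mul]
  have hPsym : ∀ x y, x ⬝ᵥ P *ᵥ y = y ⬝ᵥ P *ᵥ x := fun x y => by
    rw [hform, hform]
    exact Finset.sum_congr rfl fun k _ => dotProduct_comm _ _
  refine ⟨P, hsymm, fun x => ?_, 1 / (4 * ε), by positivity, fun x => ?_⟩
  · rw [hform]
    have := Finset.single_le_sum (f := fun k => (T ^ k *ᵥ x) ⬝ᵥ (T ^ k *ᵥ x))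
      (fun k _ => hnn _) (Finset.mem_range.2 hN)
    simpa using this
  -- The sum telescopes along `T`, so one step lowers the form by at least `|x|²/2`. Expanding `T =
  -- 1 + εK` and dropping the nonnegative `ε²` term gives the rate `1/(4ε)`.
  · have hstep : (T *ᵥ x) ⬝ᵥ P *ᵥ (T *ᵥ x) + x ⬝ᵥ x =
        x ⬝ᵥ P *ᵥ x + (T ^ N *ᵥ x) ⬝ᵥ (T ^ N *ᵥ x) := by
      have h1 := Finset.sum_range_succ (fun k => (T ^ k *ᵥ x) ⬝ᵥ (T ^ k *ᵥ x)) N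
      have h2 := Finset.sum_range_succ' (fun k => (T ^ k *ᵥ x) ⬝ᵥ (T ^ k *ᵥ x)) N
      rw [hform, hform]
      simp only [Matrix.mulVec_mulVec, ← pow_succ]
      rw [← h1, h2]
      simp
    have hexp : (T *ᵥ x) ⬝ᵥ P *ᵥ (T *ᵥ x) = x ⬝ᵥ P *ᵥ x + 2 * ε * (x ⬝ᵥ P *ᵥ (K *ᵥ x)) +
        ε ^ 2 * ((K *ᵥ x) ⬝ᵥ P *ᵥ (K *ᵥ x)) := by
      have hTx : T *ᵥ x = x + ε • (K *ᵥ x) := by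
        rw [hTdef, Matrix.add_mulVec, Matrix.one_mulVec, Matrix.smul_mulVec]
      rw [hTx]
      simp only [Matrix.mulVec_add, Matrix.mulVec_smul, add_dotProduct, dotProduct_add,
        smul_dotProduct, dotProduct_smul, smul_eq_mul]
      rw [hPsym (K *ᵥ x) x]
      ring
    have h3 := hPnn (K *ᵥ x)
    have h4 := hhalf x
    have h5 : 0 ≤ ε ^ 2 * ((K *ᵥ x) ⬝ᵥ P *ᵥ (K *ᵥ x)) := by positivity
    have h6 : 2 * ε * (x ⬝ᵥ P *ᵥ (K *ᵥ x)) ≤ -(1 / 2) * (x ⬝ᵥ x) := by linarith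
    rw [show -(1 / (4 * ε)) * (x ⬝ᵥ x) = (-(1 / 2) * (x ⬝ᵥ x)) / (2 * ε) by field_simp; ring,
      le_div_iff₀ (by positivity)]
    linarith

/-- A real matrix with nonpositive quadratic form has no eigenvalue of positive real part. -/
lemma re_nonpos_of_mem_Sp (M : Matrix ι ι ℝ) (hM : ∀ x : ι → ℝ, x ⬝ᵥ M *ᵥ x ≤ 0) {μ : ℂ}
    (hμ : μ ∈ Sp M) : μ.re ≤ 0 := by
  rw [Sp, ← Matrix.spectrum_toLin'] at hμ
  obtain ⟨v, hv, hv0⟩ := (Module.End.HasEigenvalue.of_mem_spectrum hμ).exists_hasEigenvector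
  rw [Module.End.mem_eigenspace_iff, Matrix.toLin'_apply] at hv
  -- For `v = p + iq` the cross terms cancel: `p·Mp + q·Mq = Re μ (|p|² + |q|²)`.
  set p : ι → ℝ := fun i => (v i).re with hp
  set q : ι → ℝ := fun i => (v i).im with hq
  have hre : M *ᵥ p = μ.re • p - μ.im • q := by
    ext i
    have := congrArg Complex.re (congrFun hv i)
    simpa [Matrix.mulVec, dotProduct, toComplex, hp, hq] using this
  have him : M *ᵥ q = μ.im • p + μ.re • q := by
    ext i
    have := congrArg Complex.im (congrFun hv i)
    simp [Matrix.mulVec, dotProduct, toComplex, hp, hq] at this ⊢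
    linarith
  have h1 := hM p
  have h2 := hM q
  rw [hre] at h1
  rw [him] at h2
  simp only [dotProduct_sub, dotProduct_add, dotProduct_smul, smul_eq_mul] at h1 h2
  rw [dotProduct_comm q p] at h2
  have hpos : 0 < p ⬝ᵥ p + q ⬝ᵥ q := by
    obtain ⟨i, hi⟩ := Function.ne_iff.1 hv0
    simp only [dotProduct]
    rw [← Finset.sum_add_distrib]
    refine Finset.sum_pos' (fun j _ => add_nonneg (mul_self_nonneg _) (mul_self_nonneg _)) 
      ⟨i, Finset.mem_univ i, ?_⟩
    have := Complex.normSq_pos.2 hi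
    rwa [Complex.normSq_apply] at this
  by_contra hcon
  nlinarith [mul_pos (not_le.1 hcon) hpos]

end SpectralTheory

/-! ### Derivatives of the modified loss and second-order conditions at equilibrium. -/

section Calculus

variable {n m : ℕ} {f : Euc n × Euc m → ℝ}

lemma fderiv_comp_prodMk_left {F : Type} [NormedAddCommGroup F] [NormedSpace ℝ F]
    {g : Euc n × Euc m → F} {p : Euc n × Euc m} (hg : DifferentiableAt ℝ g p) :
    fderiv ℝ (fun x => g (x, p.2)) p.1 =
      (fderiv ℝ g p).comp (ContinuousLinearMap.inl ℝ (Euc n) (Euc m)) :=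
  (HasFDerivAt.comp p.1 (g := g) (f := fun x => (x, p.2)) hg.hasFDerivAt
    (hasFDerivAt_prodMk_left p.1 p.2)).fderiv

lemma fderiv_comp_prodMk_right {F : Type} [NormedAddCommGroup F] [NormedSpace ℝ F]
    {g : Euc n × Euc m → F} {p : Euc n × Euc m} (hg : DifferentiableAt ℝ g p) :
    fderiv ℝ (fun y => g (p.1, y)) p.2 =
      (fderiv ℝ g p).comp (ContinuousLinearMap.inr ℝ (Euc n) (Euc m)) :=
  (HasFDerivAt.comp p.2 (g := g) (f := fun y => (p.1, y)) hg.hasFDerivAt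
    (hasFDerivAt_prodMk_right p.1 p.2)).fderiv

lemma gradX_eq (hf : Differentiable ℝ f) (p : Euc n × Euc m) :
    gradX f p = (InnerProductSpace.toDual ℝ (Euc n)).symm
      ((fderiv ℝ f p).comp (ContinuousLinearMap.inl ℝ (Euc n) (Euc m))) := by
  rw [gradX, gradient, fderiv_comp_prodMk_left (hf p)]

lemma gradY_eq (hf : Differentiable ℝ f) (p : Euc n × Euc m) :
    gradY f p = (InnerProductSpace.toDual ℝ (Euc m)).symm
      ((fderiv ℝ f p).comp (ContinuousLinearMap.inr ℝ (Euc n) (Euc m))) := by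
  rw [gradY, gradient, fderiv_comp_prodMk_right (hf p)]

lemma inner_gradX (hf : Differentiable ℝ f) (p : Euc n × Euc m) (v : Euc n) :
    inner ℝ (gradX f p) v = fderiv ℝ f p (v, 0) := by
  rw [gradX_eq hf, InnerProductSpace.toDual_symm_apply]
  rfl

lemma inner_gradY (hf : Differentiable ℝ f) (p : Euc n × Euc m) (w : Euc m) :
    inner ℝ (gradY f p) w = fderiv ℝ f p (0, w) := by
  rw [gradY_eq hf, InnerProductSpace.toDual_symm_apply]
  rfl

lemma contDiff_gradX (hf : ContDiff ℝ ∞ f) : ContDiff ℝ ∞ (gradX f) := by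
  rw [funext (gradX_eq (hf.differentiable (by simp)))]
  exact (InnerProductSpace.toDual ℝ (Euc n)).symm.toContinuousLinearEquiv.contDiff.comp
    ((hf.fderiv_right (m := ∞) (by simp)).clm_comp contDiff_const)

lemma contDiff_gradY (hf : ContDiff ℝ ∞ f) : ContDiff ℝ ∞ (gradY f) := by
  rw [funext (gradY_eq (hf.differentiable (by simp)))]
  exact (InnerProductSpace.toDual ℝ (Euc m)).symm.toContinuousLinearEquiv.contDiff.comp
    ((hf.fderiv_right (m := ∞) (by simp)).clm_comp contDiff_const)

lemma fderiv_fderiv_apply_const {E : Type} [NormedAddCommGroup E] [NormedSpace ℝ E] {φ : E → ℝ}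
    (hφ : ContDiff ℝ ∞ φ) (p u v : E) :
    fderiv ℝ (fun q => fderiv ℝ φ q v) p u = fderiv ℝ (fderiv ℝ φ) p u v := by
  have hd : DifferentiableAt ℝ (fderiv ℝ φ) p :=
    (hφ.fderiv_right (m := ∞) (by simp)).differentiable (by simp) p
  have := (hd.hasFDerivAt.clm_apply (hasFDerivAt_const v p)).fderiv
  rw [this]
  simp

/-- Passing to the full second derivative of `f` makes its symmetry available. -/
lemma inner_fderiv_gradX (hf : ContDiff ℝ ∞ f) (p u : Euc n × Euc m) (v : Euc n) :
    inner ℝ (fderiv ℝ (gradX f) p u) v = fderiv ℝ (fderiv ℝ f) p u (v, 0) := by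
  rw [← fderiv_fderiv_apply_const hf,
    ← funext fun q => inner_gradX (hf.differentiable (by simp)) q v,
    fderiv_inner_apply ℝ ((contDiff_gradX hf).differentiable (by simp) p)
      (differentiableAt_const v)]
  simp

lemma inner_fderiv_gradY (hf : ContDiff ℝ ∞ f) (p u : Euc n × Euc m) (w : Euc m) :
    inner ℝ (fderiv ℝ (gradY f) p u) w = fderiv ℝ (fderiv ℝ f) p u (0, w) := by
  rw [← fderiv_fderiv_apply_const hf,
    ← funext fun q => inner_gradY (hf.differentiable (by simp)) q w,
    fderiv_inner_apply ℝ ((contDiff_gradY hf).differentiable (by simp) p)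
      (differentiableAt_const w)]
  simp

lemma fderiv_fderiv_comm {E : Type} [NormedAddCommGroup E] [NormedSpace ℝ E] {φ : E → ℝ}
    (hφ : ContDiff ℝ ∞ φ) (p u v : E) :
    fderiv ℝ (fderiv ℝ φ) p u v = fderiv ℝ (fderiv ℝ φ) p v u :=
  (hφ.contDiffAt.isSymmSndFDerivAt
    (by rw [minSmoothness_of_isRCLikeNormedField]; exact WithTop.coe_le_coe.2 (le_top : (2 : ℕ∞) ≤ ⊤))).eq u v

/-- The second derivative of `‖φ‖²` at a zero of `φ`. -/
lemma fderiv_fderiv_norm_sq {E F : Type} [NormedAddCommGroup E] [NormedSpace ℝ E]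
    [NormedAddCommGroup F] [InnerProductSpace ℝ F] {φ : E → F} (hφ : ContDiff ℝ ∞ φ) {p : E}
    (hp : φ p = 0) (u v : E) :
    fderiv ℝ (fderiv ℝ fun q => ‖φ q‖ ^ 2) p u v =
      2 * inner ℝ (fderiv ℝ φ p u) (fderiv ℝ φ p v) := by
  have hd : Differentiable ℝ φ := hφ.differentiable (by simp)
  have hd' : Differentiable ℝ (fderiv ℝ φ) :=
    (hφ.fderiv_right (m := ∞) (by simp)).differentiable (by simp)
  have h1 : (fun q => fderiv ℝ (fun q => ‖φ q‖ ^ 2) q v) =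
      fun q => 2 * inner ℝ (φ q) (fderiv ℝ φ q v) := by
    ext q
    rw [((hd q).hasFDerivAt.norm_sq).fderiv]
    simp
  rw [← fderiv_fderiv_apply_const (hφ.norm_sq ℝ), h1]
  have hdv : DifferentiableAt ℝ (fun q => fderiv ℝ φ q v) p :=
    (hd' p).clm_apply (differentiableAt_const v)
  rw [fderiv_const_mul ((hd p).inner ℝ hdv)]
  -- The second derivative of `φ` appears only paired with `φ p = 0`.
  rw [_root_.smul_apply, fderiv_inner_apply ℝ (hd p) hdv, hp]
  simp

lemma contDiff_modifiedLoss (hf : ContDiff ℝ ∞ f) (β h : ℝ) :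
    ContDiff ℝ ∞ (modifiedLoss f β h) :=
  (contDiff_const.mul hf).add (contDiff_const.mul
    (((contDiff_gradX hf).norm_sq ℝ).sub ((contDiff_gradY hf).norm_sq ℝ)))

lemma fderiv_modifiedLoss (hf : ContDiff ℝ ∞ f) (β h : ℝ) :
    fderiv ℝ (modifiedLoss f β h) = fun p => (1 / (1 - β)) • fderiv ℝ f p +
      (h * (1 + β) / (4 * (1 - β) ^ 3)) • (fderiv ℝ (fun q => ‖gradX f q‖ ^ 2) p -
        fderiv ℝ (fun q => ‖gradY f q‖ ^ 2) p) := by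
  ext1 p
  have h1 := (hf.differentiable (by simp) p).hasFDerivAt
  have h2 := (((contDiff_gradX hf).norm_sq ℝ).differentiable (by simp) p).hasFDerivAt
  have h3 := (((contDiff_gradY hf).norm_sq ℝ).differentiable (by simp) p).hasFDerivAt
  exact ((h1.const_mul _).add ((h2.sub h3).const_mul _)).fderiv

/-- The Hessian of the modified loss at a critical point. -/
lemma fderiv_fderiv_modifiedLoss (hf : ContDiff ℝ ∞ f) (β h : ℝ) {p : Euc n × Euc m}
    (hX : gradX f p = 0) (hY : gradY f p = 0) (u v : Euc n × Euc m) :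
    fderiv ℝ (fderiv ℝ (modifiedLoss f β h)) p u v =
      1 / (1 - β) * fderiv ℝ (fderiv ℝ f) p u v + h * (1 + β) / (2 * (1 - β) ^ 3) *
        (inner ℝ (fderiv ℝ (gradX f) p u) (fderiv ℝ (gradX f) p v) -
          inner ℝ (fderiv ℝ (gradY f) p u) (fderiv ℝ (gradY f) p v)) := by
  have hd : ∀ {φ : Euc n × Euc m → ℝ}, ContDiff ℝ ∞ φ →
      HasFDerivAt (fderiv ℝ φ) (fderiv ℝ (fderiv ℝ φ) p) p := fun hφ =>
    ((hφ.fderiv_right (m := ∞) (by simp)).differentiable (by simp) p).hasFDerivAt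
  have h1 := hd hf
  have h2 := hd ((contDiff_gradX hf).norm_sq ℝ)
  have h3 := hd ((contDiff_gradY hf).norm_sq ℝ)
  have h4 := ((h1.const_smul (1 / (1 - β))).add
    ((h2.sub h3).const_smul (h * (1 + β) / (4 * (1 - β) ^ 3)))).fderiv
  rw [fderiv_modifiedLoss hf]
  refine (congrArg (fun A => A u v) h4).trans ?_
  simp only [_root_.add_apply, _root_.smul_apply, _root_.sub_apply, smul_eq_mul]
  rw [fderiv_fderiv_norm_sq (contDiff_gradX hf) hX, fderiv_fderiv_norm_sq (contDiff_gradY hf) hY]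
  generalize (1 - β) ^ 3 = d
  ring

/-- The linearization of the gradient descent-ascent flow. -/
def gdaDeriv (f : Euc n × Euc m → ℝ) (p : Euc n × Euc m) :
    Euc n × Euc m →L[ℝ] Euc n × Euc m :=
  (-fderiv ℝ (gradX f) p).prod (fderiv ℝ (gradY f) p)

lemma contDiff_simHBField (hf : ContDiff ℝ ∞ f) (β h : ℝ) : ContDiff ℝ ∞ (simHBField f β h) :=
  (contDiff_gradX (contDiff_modifiedLoss hf β h)).neg.prodMk
    (contDiff_gradY (contDiff_modifiedLoss hf β h))

/-- At a critical point, the linearization of Continuous Sim-HB is a quadratic polynomial in the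
linearization of gradient descent-ascent. -/
lemma hasFDerivAt_simHBField (hf : ContDiff ℝ ∞ f) (β h : ℝ) {p : Euc n × Euc m}
    (hX : gradX f p = 0) (hY : gradY f p = 0) :
    HasFDerivAt (simHBField f β h) ((1 / (1 - β)) • gdaDeriv f p -
      (h * (1 + β) / (2 * (1 - β) ^ 3)) • (gdaDeriv f p).comp (gdaDeriv f p)) p := by
  have hF := contDiff_modifiedLoss hf β h
  have h1 := ((contDiff_gradX hF).differentiable (by simp) p).hasFDerivAt
  have h2 := ((contDiff_gradY hF).differentiable (by simp) p).hasFDerivAt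
  refine (h1.neg.prodMk h2).congr_fderiv ?_
  -- This is `H(Ju, v)`: by symmetry of `H`, the Gram terms in the Hessian of `ℱ` equal `-H(Ju, v)`,
  -- which become `-J²` after the sign flip `Λ`.
  have hJ : ∀ u v, fderiv ℝ (fderiv ℝ f) p (gdaDeriv f p u) v =
      -inner ℝ (fderiv ℝ (gradX f) p u) (fderiv ℝ (gradX f) p v) +
        inner ℝ (fderiv ℝ (gradY f) p u) (fderiv ℝ (gradY f) p v) := by
    intro u v
    have hsplit : gdaDeriv f p u =
        -(fderiv ℝ (gradX f) p u, (0 : Euc m)) + ((0 : Euc n), fderiv ℝ (gradY f) p u) := by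
      simp [gdaDeriv]
    rw [fderiv_fderiv_comm hf, hsplit, map_add, map_neg, ← inner_fderiv_gradX hf,
      ← inner_fderiv_gradY hf, real_inner_comm, real_inner_comm (fderiv ℝ (gradY f) p u)]
  refine ContinuousLinearMap.ext fun u => Prod.ext ?_ ?_
  · refine ext_inner_right ℝ fun v => ?_
    have h3 := hJ u (v, 0)
    rw [← inner_fderiv_gradX hf] at h3
    have h4 : inner ℝ (-(fderiv ℝ (gradX (modifiedLoss f β h)) p u)) v =
        inner ℝ ((1 / (1 - β)) • (-fderiv ℝ (gradX f) p u) -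
          (h * (1 + β) / (2 * (1 - β) ^ 3)) • (-fderiv ℝ (gradX f) p (gdaDeriv f p u))) v := by
      simp only [inner_sub_left, inner_smul_left, inner_neg_left, h3, inner_fderiv_gradX hF,
        inner_fderiv_gradX hf, fderiv_fderiv_modifiedLoss hf β h hX hY, conj_trivial]
      ring
    exact h4
  · refine ext_inner_right ℝ fun w => ?_
    have h3 := hJ u (0, w)
    rw [← inner_fderiv_gradY hf] at h3
    have h4 : inner ℝ (fderiv ℝ (gradY (modifiedLoss f β h)) p u) w =
        inner ℝ ((1 / (1 - β)) • (fderiv ℝ (gradY f) p u) -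
          (h * (1 + β) / (2 * (1 - β) ^ 3)) • (fderiv ℝ (gradY f) p (gdaDeriv f p u))) w := by
      simp only [inner_sub_left, inner_smul_left, h3, inner_fderiv_gradY hF,
        inner_fderiv_gradY hf, fderiv_fderiv_modifiedLoss hf β h hX hY, conj_trivial]
      ring
    exact h4

/-- Squared norms have zero derivative where the gradients vanish, so there `dℱ` is a multiple of
`df`. -/
lemma simHBField_eq_zero (hf : ContDiff ℝ ∞ f) (β h : ℝ) {p : Euc n × Euc m}
    (hX : gradX f p = 0) (hY : gradY f p = 0) : simHBField f β h p = 0 := by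
  have hd := hf.differentiable (by simp)
  have hF := (contDiff_modifiedLoss hf β h).differentiable (by simp)
  have hsq : ∀ {k : ℕ} {φ : Euc n × Euc m → Euc k}, ContDiff ℝ ∞ φ → φ p = 0 →
      fderiv ℝ (fun q => ‖φ q‖ ^ 2) p = 0 := by
    intro k φ hφ h0
    rw [((hφ.differentiable (by simp) p).hasFDerivAt.norm_sq).fderiv, h0]
    ext v <;> simp
  have hzero : ∀ v, fderiv ℝ (modifiedLoss f β h) p v = 1 / (1 - β) * fderiv ℝ f p v := by
    intro v
    rw [fderiv_modifiedLoss hf]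
    simp only [hsq (contDiff_gradX hf) hX, hsq (contDiff_gradY hf) hY]
    simp
  refine Prod.ext ?_ ?_
  · refine ext_inner_right ℝ fun v => ?_
    change inner ℝ (-gradX (modifiedLoss f β h) p) v = inner ℝ (0 : Euc n) v
    rw [inner_neg_left, inner_gradX hF, hzero, ← inner_gradX hd, hX]
    simp
  · refine ext_inner_right ℝ fun w => ?_
    change inner ℝ (gradY (modifiedLoss f β h) p) w = inner ℝ (0 : Euc m) w
    rw [inner_gradY hF, hzero, ← inner_gradY hd, hY]
    simp

/-- The second-order necessary condition for a local minimum along a line. -/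
lemma fderiv_fderiv_nonneg_of_isLocalMin {E : Type} [NormedAddCommGroup E] [NormedSpace ℝ E]
    {φ : E → ℝ} (hφ : ContDiff ℝ ∞ φ) {p u : E} (hmin : IsLocalMin (fun t : ℝ => φ (p + t • u)) 0) :
    0 ≤ fderiv ℝ (fderiv ℝ φ) p u u := by
  have hline : ∀ t : ℝ, HasDerivAt (fun t : ℝ => p + t • u) u t := fun t => by
    simpa using ((hasDerivAt_id t).smul_const u).const_add p
  have hd1 : deriv (fun t : ℝ => φ (p + t • u)) = fun t => fderiv ℝ φ (p + t • u) u := by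
    ext t
    exact ((hφ.differentiable (by simp) _).hasFDerivAt.comp_hasDerivAt t (hline t)).deriv
  have hd2 : deriv (deriv fun t : ℝ => φ (p + t • u)) 0 = fderiv ℝ (fderiv ℝ φ) p u u := by
    have hdd : DifferentiableAt ℝ (fun q => fderiv ℝ φ q u) (p + (0 : ℝ) • u) :=
      ((hφ.fderiv_right (m := ∞) (by simp)).clm_apply contDiff_const).differentiable (by simp) _
    rw [hd1, ← fderiv_fderiv_apply_const hφ]
    have := (hdd.hasFDerivAt.comp_hasDerivAt (0 : ℝ) (hline 0)).deriv
    simpa [Function.comp_def] using this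
  by_contra hneg
  rw [← hd2, not_le] at hneg
  have hcont : Continuous fun t : ℝ => φ (p + t • u) :=
    hφ.continuous.comp (by fun_prop)
  -- A negative second derivative would make the minimum also a local maximum, hence the function
  -- locally constant with zero second derivative.
  have hmax := isLocalMax_of_deriv_deriv_neg hneg hmin.deriv_eq_zero hcont.continuousAt
  have hconst : (fun t : ℝ => φ (p + t • u)) =ᶠ[𝓝 0] fun _ => φ (p + (0 : ℝ) • u) := by
    filter_upwards [hmin, hmax] with t h1 h2
    exact le_antisymm h2 h1
  have h0 := hconst.deriv.deriv_eq
  simp only [deriv_const'] at h0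
  rw [h0] at hneg
  exact lt_irrefl _ hneg

variable {xs : Euc n} {ys : Euc m}

lemma IsLocalNash.isLocalMin (hN : IsLocalNash f xs ys) : IsLocalMin (fun x => f (x, ys)) xs := by
  obtain ⟨U, hU, V, hV, h1, h2⟩ := hN
  filter_upwards [hU] with x hx using h1 x hx

lemma IsLocalNash.isLocalMax (hN : IsLocalNash f xs ys) : IsLocalMax (fun y => f (xs, y)) ys := by
  obtain ⟨U, hU, V, hV, h1, h2⟩ := hN
  filter_upwards [hV] with y hy using h2 y hy

lemma IsLocalNash.gradX_eq_zero (hN : IsLocalNash f xs ys) : gradX f (xs, ys) = 0 := by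
  rw [gradX, gradient, hN.isLocalMin.fderiv_eq_zero, map_zero]

lemma IsLocalNash.gradY_eq_zero (hN : IsLocalNash f xs ys) : gradY f (xs, ys) = 0 := by
  rw [gradY, gradient, hN.isLocalMax.fderiv_eq_zero, map_zero]

lemma IsLocalNash.hess_x_nonneg (hf : ContDiff ℝ ∞ f) (hN : IsLocalNash f xs ys) (v : Euc n) :
    0 ≤ fderiv ℝ (fderiv ℝ f) (xs, ys) (v, 0) (v, 0) := by
  refine fderiv_fderiv_nonneg_of_isLocalMin hf ?_
  have hc : ContinuousAt (fun t : ℝ => xs + t • v) 0 := by fun_prop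
  have hmin := hN.isLocalMin
  have := IsLocalMin.comp_continuous (g := fun t : ℝ => xs + t • v) (b := 0)
    (f := fun x => f (x, ys)) (by simpa using hmin) hc
  simpa [Function.comp_def] using this

lemma IsLocalNash.hess_y_nonpos (hf : ContDiff ℝ ∞ f) (hN : IsLocalNash f xs ys) (w : Euc m) :
    fderiv ℝ (fderiv ℝ f) (xs, ys) (0, w) (0, w) ≤ 0 := by
  have hc : ContinuousAt (fun t : ℝ => ys + t • w) 0 := by fun_prop
  have hmax := hN.isLocalMax
  have h1 := IsLocalMax.comp_continuous (g := fun t : ℝ => ys + t • w) (b := 0)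
    (f := fun y => f (xs, y)) (by simpa using hmax) hc
  have h2 := fderiv_fderiv_nonneg_of_isLocalMin (φ := fun q => -f q) (p := (xs, ys)) (u := (0, w))
    hf.neg (by simpa [Function.comp_def] using h1.neg)
  have h3 : fderiv ℝ (fun q => -f q) = fun q => -fderiv ℝ f q := by
    ext1 q; exact fderiv_neg
  rw [h3, show (fun q => -fderiv ℝ f q) = -fderiv ℝ f from rfl, fderiv_neg] at h2
  simpa using h2

end Calculus

/-! ### Passage between the product space and block matrices. -/

section Coordinates

open Matrix

variable {n m : ℕ} {f : Euc n × Euc m → ℝ}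

/-- The coordinates of a point of `ℝⁿ × ℝᵐ`. -/
def coords : Euc n × Euc m →ₗ[ℝ] (Fin n ⊕ Fin m → ℝ) where
  toFun u := Sum.elim u.1 u.2
  map_add' u v := by ext (i | i) <;> simp
  map_smul' c u := by ext (i | i) <;> simp

lemma coords_surjective (x : Fin n ⊕ Fin m → ℝ) : ∃ u : Euc n × Euc m, coords u = x :=
  ⟨(WithLp.toLp 2 fun i => x (.inl i), WithLp.toLp 2 fun i => x (.inr i)), by
    ext (i | i) <;> simp [coords]⟩

lemma coords_dotProduct (u v : Euc n × Euc m) :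
    coords u ⬝ᵥ coords v = inner ℝ u.1 v.1 + inner ℝ u.2 v.2 := by
  simp [coords, dotProduct, Fintype.sum_sum_type, PiLp.inner_apply, mul_comm]

/-- The product carries the sup norm, so only an inequality holds; this direction serves both
Lyapunov bounds. -/
lemma norm_sq_le_coords_dotProduct (u : Euc n × Euc m) : ‖u‖ ^ 2 ≤ coords u ⬝ᵥ coords u := by
  rw [coords_dotProduct, real_inner_self_eq_norm_sq, real_inner_self_eq_norm_sq, Prod.norm_def]
  rcases max_cases ‖u.1‖ ‖u.2‖ with h | h <;> rw [h.1] <;>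
    nlinarith [sq_nonneg ‖u.1‖, sq_nonneg ‖u.2‖]

lemma jacobianMatrix_mulVec {k l : ℕ} (g : Euc k → Euc l) (x v : Euc k) (i : Fin l) :
    (jacobianMatrix g x *ᵥ v) i = fderiv ℝ g x v i := by
  conv_rhs => rw [← (EuclideanSpace.basisFun (Fin k) ℝ).sum_repr v]
  simp [jacobianMatrix, Matrix.mulVec, dotProduct, mul_comm]

lemma coords_gdaDeriv (hf : ContDiff ℝ ∞ f) (p u : Euc n × Euc m) :
    coords (gdaDeriv f p u) = gdaJacobian f p *ᵥ coords u := by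
  have hX := (contDiff_gradX hf).differentiable (by simp) p
  have hY := (contDiff_gradY hf).differentiable (by simp) p
  have hu : u = (u.1, 0) + (0, u.2) := by simp
  have hcoords : coords u = Sum.elim u.1 u.2 := rfl
  rw [hcoords, gdaJacobian, Matrix.fromBlocks_mulVec]
  ext (i | i)
  · simp only [Sum.elim_inl, Sum.elim_comp_inl, Sum.elim_comp_inr, Matrix.neg_mulVec,
      Pi.add_apply, Pi.neg_apply, hessXX, hessXY, jacobianMatrix_mulVec,
      fderiv_comp_prodMk_left hX, fderiv_comp_prodMk_right hX]
    change -(fderiv ℝ (gradX f) p u) i = _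
    conv_lhs => rw [hu, map_add]
    simp
    ring
  · simp only [Sum.elim_inr, Sum.elim_comp_inl, Sum.elim_comp_inr,
      Pi.add_apply, hessYX, hessYY, jacobianMatrix_mulVec,
      fderiv_comp_prodMk_left hY, fderiv_comp_prodMk_right hY]
    change (fderiv ℝ (gradY f) p u) i = _
    conv_lhs => rw [hu, map_add]
    simp

/-- At a local Nash equilibrium the Jacobian has nonpositive quadratic form. -/
lemma IsLocalNash.gdaJacobian_nonpos {xs : Euc n} {ys : Euc m} (hf : ContDiff ℝ ∞ f)
    (hN : IsLocalNash f xs ys) (x : Fin n ⊕ Fin m → ℝ) :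
    x ⬝ᵥ gdaJacobian f (xs, ys) *ᵥ x ≤ 0 := by
  obtain ⟨u, rfl⟩ := coords_surjective x
  rw [← coords_gdaDeriv hf, coords_dotProduct]
  have h1 : inner ℝ u.1 (gdaDeriv f (xs, ys) u).1 =
      -fderiv ℝ (fderiv ℝ f) (xs, ys) u (u.1, 0) := by
    rw [← inner_fderiv_gradX hf, real_inner_comm, ← inner_neg_left]
    rfl
  have h2 : inner ℝ u.2 (gdaDeriv f (xs, ys) u).2 =
      fderiv ℝ (fderiv ℝ f) (xs, ys) u (0, u.2) := by
    rw [← inner_fderiv_gradY hf, real_inner_comm]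
    rfl
  have hu : ∀ v, fderiv ℝ (fderiv ℝ f) (xs, ys) u v =
      fderiv ℝ (fderiv ℝ f) (xs, ys) (u.1, 0) v + fderiv ℝ (fderiv ℝ f) (xs, ys) (0, u.2) v := by
    intro v
    rw [← _root_.add_apply, ← map_add]
    simp
  -- The mixed terms cancel by symmetry: `𝒜` is skew and only `𝒮` contributes.
  rw [h1, h2, hu, hu, fderiv_fderiv_comm hf (xs, ys) (0, u.2) (u.1, 0)]
  linarith [hN.hess_x_nonneg hf u.1, hN.hess_y_nonpos hf u.2]

end Coordinates

end MinMaxGame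
end

/-! ### Stability of the linearization and conclusion. -/

theorem theorem4p6 {n m : ℕ}
    (f : MinMaxGame.Euc n × MinMaxGame.Euc m → ℝ) (hf : ContDiff ℝ ∞ f)
    (xs : MinMaxGame.Euc n) (ys : MinMaxGame.Euc m)
    (hNash : MinMaxGame.IsLocalNash f xs ys)
    (hInteraction : MinMaxGame.DominantInteraction f (xs, ys))
    (hEigVec : MinMaxGame.EigVecKerTrivial f (xs, ys))
    (β h : ℝ) (hβ : β ∈ Set.Ioo (-1 : ℝ) 1) (hpos : 0 < h)
    (hstep : ∀ μ ∈ MinMaxGame.Sp (MinMaxGame.gdaJacobian f (xs, ys)),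
      h < 2 * (1 - β) ^ 2 / (1 + β) * (|μ.re| / (μ.im ^ 2 - μ.re ^ 2))) :
    MinMaxGame.LocallyConverges (MinMaxGame.simHBField f β h) (xs, ys) := by
  open MinMaxGame Matrix in
  have hX := hNash.gradX_eq_zero
  have hY := hNash.gradY_eq_zero
  have hβ1 : 0 < 1 - β := sub_pos.2 hβ.2
  have hβ2 : 0 < 1 + β := by linarith [hβ.1]
  set a : ℝ := 1 / (1 - β) with ha
  set b : ℝ := h * (1 + β) / (2 * (1 - β) ^ 3) with hb
  have hapos : 0 < a := by positivity
  have hbpos : 0 < b := by positivity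
  set J := gdaJacobian f (xs, ys) with hJ
  set K := (0 : ℝ) • (1 : Matrix (Fin n ⊕ Fin m) (Fin n ⊕ Fin m) ℝ) + a • J + (-b) • (J * J) with hK
  have hspec : ∀ μ ∈ Sp K, μ.re < 0 := by
    intro μ hμ
    obtain ⟨ν, hν, rfl⟩ := exists_of_mem_Sp_quadratic J (.inl hapos.ne') hμ
    have hν0 : ν.re ≤ 0 := re_nonpos_of_mem_Sp J (hNash.gdaJacobian_nonpos hf) hν
    have hgap : 0 < ν.im ^ 2 - ν.re ^ 2 := sub_pos.2 (sq_lt_sq.2 (hInteraction ν hν))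
    have hh := hstep ν hν
    rw [abs_of_nonpos hν0, div_mul_div_comm, lt_div_iff₀ (by positivity)] at hh
    -- This is the step-size bound multiplied by `(1+β)/(2(1-β)³)` and the positive gap.
    have hkey : b * (ν.im ^ 2 - ν.re ^ 2) < a * -ν.re := by
      rw [hb, ha, div_mul_eq_mul_div, div_mul_eq_mul_div,
        div_lt_div_iff₀ (by positivity) (by positivity)]
      have := mul_lt_mul_of_pos_right hh hβ1
      nlinarith
    have hre : ((0 : ℝ) + a * ν + (-b : ℝ) * ν ^ 2 : ℂ).re =
        a * ν.re + b * (ν.im ^ 2 - ν.re ^ 2) := by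
      simp [pow_two]
      ring
    rw [hre]
    linarith
  obtain ⟨P, hPsymm, hPlow, c, hc, hPneg⟩ := exists_lyapunov_matrix K hspec
  let B : Euc n × Euc m →L[ℝ] Euc n × Euc m →L[ℝ] ℝ :=
    ((Matrix.toLinearMap₂' ℝ P).compl₁₂ coords coords).toContinuousBilinearMap
  have hB : ∀ u v, B u v = coords u ⬝ᵥ P *ᵥ coords v := fun u v =>
    Matrix.toLinearMap₂'_apply' P (coords u) (coords v)
  refine locallyConverges_of_quadratic_lyapunov
    ((contDiff_simHBField hf β h).contDiffAt.of_le (by simp)) (simHBField_eq_zero hf β h hX hY)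
    (hasFDerivAt_simHBField hf β h hX hY) B ?_ one_pos hc ?_ ?_
  · intro u v
    rw [hB, hB, Matrix.dotProduct_mulVec, ← Matrix.mulVec_transpose, hPsymm, dotProduct_comm]
  · intro u
    rw [hB, one_mul]
    exact (norm_sq_le_coords_dotProduct u).trans (hPlow _)
  · intro u
    have hKu : coords ((a • gdaDeriv f (xs, ys) -
        b • (gdaDeriv f (xs, ys)).comp (gdaDeriv f (xs, ys))) u) = K *ᵥ coords u := by
      rw [hK, hJ]
      simp [Matrix.add_mulVec, Matrix.smul_mulVec, coords_gdaDeriv hf, Matrix.mulVec_mulVec,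
        Matrix.neg_mulVec, sub_eq_add_neg]
    rw [hB, hKu]
    refine (hPneg _).trans ?_
    rw [neg_mul, neg_mul, neg_le_neg_iff]
    exact mul_le_mul_of_nonneg_left (norm_sq_le_coords_dotProduct u) hc.le
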